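/- Conventions. All topological spaces are metrizable and carry their Borel $\sigma$-algebra; a space is Souslin if it is the image of a complete separable metric space under a continuous map. $\Delta(X)$ is the set of Borel probability measures on $X$ with the topology of weak convergence. For a non-empty family $\mathcal B$ of non-empty Borel subsets of $X$ (conditioning events), $\Delta^{\mathcal B}(X)\subseteq\Delta(X)^{\mathcal B}$ (with the product topology) is the set of conditional probability systems (CPSs): arrays $(\mu(\cdot|B))_{B\in\mathcal B}$ of probability measures with $\mu(B|B)=1$ for all $B\in\mathcal B$ and $\mu(A|B)\,\mu(B|C)=\mu(A|C)$ whenever $A\subseteq B\subseteq C$, $A$ is Borel and $B,C\in\mathcal B$. For $\mathcal B$ on $X$, $\Delta^{\mathcal B}(X\times Y)$ denotes the set of CPSs on $X\times Y$ with conditioning events $B\times Y$, $B\in\mathcal B$. A measurable $f:X\to Y$ such that the conditioning events of $X$ are exactly the sets $f^{-1}(C)$, $C$ a conditioning event of $Y$, induces the pushforward $\overline{\mathcal L}_f(\mu)(E|C)=\mu(f^{-1}(E)|f^{-1}(C))$ of CPSs. Fix two players $i\in I$ (the co-player of $i$ is written $j$), a Souslin space $S$, and for each $i$ a countable family $\mathcal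 B_i$ of conditioning events of $S$. An $(S,(\mathcal B_i)_{i\in I})$-based type structure $\mathcal T$ consists of non-empty metrizable type sets $T_i$ and Borel measurable belief maps $\beta_i:T_i\to\Delta^{\mathcal B_i}(S\times T_j)$, $i\in I$. It is Souslin (resp. compact) if each $T_i$ is, continuous if each $\beta_i$ is continuous, and complete if each $\beta_i$ is surjective. Hierarchies. Put $\Theta_i^0=S$, $H_i^1=\Delta^{\mathcal B_i}(S)$, and for $n\ge1$ put $\Theta_i^n=S\times H_j^n$, let $\rho_i^{n-1,n}:\Theta_i^n\to\Theta_i^{n-1}$ be the coordinate projection, and let $H_i^{n+1}$ be the set of $((\mu^1,\dots,\mu^n),\mu^{n+1})\in H_i^n\times\Delta^{\mathcal B_i}(\Theta_i^n)$ with $\overline{\mathcal L}_{\rho_i^{n-1,n}}(\mu^{n+1})=\mu^n$. Let $H_i$ be the set of sequences $(\mu^1,\mu^2,\dots)\in\prod_{n\ge0}\Delta^{\mathcal B_i}(\Theta_i^n)$ with $(\mu^1,\dots,\mu^n)\in H_i^n$ for all $n\ge1$ (the collectively coherent hierarchies of player $i$). In a type structure, let $h_{-i}^0:S\times T_j\to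 S$ be the projection, and define recursively, for $n\ge0$, $h_i^{n+1}(t_i)=\big(\overline{\mathcal L}_{h_{-i}^0}(\beta_i(t_i)),\dots,\overline{\mathcal L}_{h_{-i}^n}(\beta_i(t_i))\big)\in H_i^{n+1}$ and $h_{-i}^{n+1}=(\mathrm{Id}_S,h_j^{n+1}):S\times T_j\to\Theta_i^{n+1}$; let $h_i(t_i)=\big(\overline{\mathcal L}_{h_{-i}^n}(\beta_i(t_i))\big)_{n\ge0}\in H_i$. $\mathcal T$ is finitely terminal if for every $(S,(\mathcal B_i)_{i\in I})$-based type structure $\mathcal T^*$ (with maps $h_i^{*,n}$, $h_i^*$), every $i$, every $t_i^*\in T_i^*$ and every $n\ge1$ there is $t_i\in T_i$ with $h_i^{*,n}(t_i^*)=h_i^n(t_i)$; it is terminal if for every such $\mathcal T^*$, $i$ and $t_i^*$ there is $t_i\in T_i$ with $h_i^*(t_i^*)=h_i(t_i)$. Theorem. Let $\mathcal T$ be an $(S,(\mathcal B_i)_{i\in I})$-based type structure. (i) If $\mathcal T$ is Souslin and complete, then $\mathcal T$ is finitely terminal, and $h_i^n(T_i)=H_i^n$ for all $i\in I$ and $n\ge1$.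 (ii) If $\mathcal T$ is complete, compact and continuous, then $\mathcal T$ is terminal, and $h_i(T_i)=H_i$ for all $i\in I$. -/

import Mathlib

open MeasureTheory Set Filter Topology TopologicalSpace
open scoped ENNReal NNReal

universe u v w

/-! ### Souslin spaces -/

/-- A topological space is Souslin if it is the image of a complete separable metric space under
a continuous map. (`AnalyticSet s` says that `s` is a continuous image of a Polish space.)
Metrizability is always assumed separately. -/
class SouslinSpace (X : Type u) [TopologicalSpace X] : Prop where
  analyticSet_univ : AnalyticSet (univ : Set X)

instance SouslinSpace.secondCountableTopology (X : Type u) [TopologicalSpace X]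
    [MetrizableSpace X] [h : SouslinSpace X] : SecondCountableTopology X := by
  let _ := metrizableSpaceMetric X
  have hsep : SeparableSpace X := by
    rcases (AnalyticSet_def (univ : Set X) ▸ h.analyticSet_univ) with h0 | ⟨f, hf, hr⟩
    · have : IsEmpty X := univ_eq_empty_iff.mp h0
      infer_instance
    · have : DenseRange f := (range_eq_univ.mp hr).denseRange
      exact this.separableSpace hf
  exact UniformSpace.secondCountable_of_separable X

/-! ### The weak topology on probability measures over a separable metrizable space -/

namespace WeakTopology

/-- The set of probability measures giving an open set mass more than `q` is weakly open. -/
theorem isOpen_lt_measure {X : Type u} [TopologicalSpace X] [PseudoMetrizableSpace X]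
    [MeasurableSpace X] [BorelSpace X] {G : Set X} (hG : IsOpen G) (q : ℝ≥0∞) :
    IsOpen {μ : ProbabilityMeasure X | q < (μ : Measure X) G} := by
  let _ := pseudoMetrizableSpacePseudoMetric X
  rw [isOpen_iff_mem_nhds]
  intro μ hμ
  have h1 : (μ : Measure X) G ≤ (𝓝 μ).liminf fun ν : ProbabilityMeasure X => (ν : Measure X) G :=
    ProbabilityMeasure.le_liminf_measure_open_of_tendsto (μs := id) tendsto_id hG
  exact eventually_lt_of_lt_liminf (lt_of_lt_of_le hμ h1)

/-- Evaluation at a Borel set is Borel measurable for the weak topology. -/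
theorem measurable_eval {X : Type u} [TopologicalSpace X] [PseudoMetrizableSpace X]
    [MeasurableSpace X] [BorelSpace X] {A : Set X} (hA : MeasurableSet A) :
    Measurable[borel (ProbabilityMeasure X)] fun μ : ProbabilityMeasure X => (μ : Measure X) A := by
  have key : @Measurable _ _ (borel (ProbabilityMeasure X)) _
      (fun μ : ProbabilityMeasure X => (μ : Measure X)) := by
    refine @Measurable.measure_of_isPiSystem_of_isProbabilityMeasure _ _
      (borel (ProbabilityMeasure X)) _ _ (fun μ => inferInstance) {G : Set X | IsOpen G}
      (BorelSpace.measurable_eq (α := X)) isPiSystem_isOpen ?_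
    intro G hG
    refine @measurable_of_Ioi _ _ _ _ _ (borel (ProbabilityMeasure X)) _ _ _ _ ?_
    intro q
    exact MeasurableSpace.measurableSet_generateFrom (isOpen_lt_measure hG q)
  exact (Measure.measurable_coe hA).comp key

/-- A countable family of weakly open sets. -/
def subbasis (X : Type u) [TopologicalSpace X] [SecondCountableTopology X] [MeasurableSpace X] :
    Set (Set (ProbabilityMeasure X)) :=
  ⋃ F ∈ {F : Set (Set X) | F.Finite ∧ F ⊆ countableBasis X}, ⋃ q : ℚ,
    {{μ : ProbabilityMeasure X | ENNReal.ofReal q < (μ : Measure X) (⋃₀ F)}}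

theorem countable_subbasis (X : Type u) [TopologicalSpace X] [SecondCountableTopology X]
    [MeasurableSpace X] : (subbasis X).Countable := by
  refine Countable.biUnion (countable_ofPred_finite_subset (countable_countableBasis X)) ?_
  intro F _
  exact countable_iUnion fun q => countable_singleton _

theorem mem_subbasis {X : Type u} [TopologicalSpace X] [SecondCountableTopology X]
    [MeasurableSpace X] {U : Set (ProbabilityMeasure X)} :
    U ∈ subbasis X ↔ ∃ F : Set (Set X), (F.Finite ∧ F ⊆ countableBasis X) ∧
      ∃ q : ℚ, U = {μ : ProbabilityMeasure X | ENNReal.ofReal q < (μ : Measure X) (⋃₀ F)} := by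
  simp [subbasis, eq_comm]

theorem eq_generateFrom (X : Type u) [TopologicalSpace X] [PseudoMetrizableSpace X]
    [SecondCountableTopology X] [MeasurableSpace X] [BorelSpace X] :
    (inferInstance : TopologicalSpace (ProbabilityMeasure X)) = generateFrom (subbasis X) := by
  let _ := pseudoMetrizableSpacePseudoMetric X
  refine le_antisymm ?_ ?_
  · refine le_generateFrom fun U hU => ?_
    obtain ⟨F, ⟨-, hF⟩, q, rfl⟩ := mem_subbasis.mp hU
    exact isOpen_lt_measure (isOpen_sUnion fun G hG => isOpen_of_mem_countableBasis (hF hG)) _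
  · have hsc : @SecondCountableTopology _ (generateFrom (subbasis X)) :=
      @SecondCountableTopology.mk _ (generateFrom (subbasis X))
        ⟨_, countable_subbasis X, rfl⟩
    refine le_of_nhds_le_nhds fun μ => ?_
    have hcg : (@nhds _ (generateFrom (subbasis X)) μ).IsCountablyGenerated :=
      @FirstCountableTopology.nhds_generated_countable _ (generateFrom (subbasis X))
        (@SecondCountableTopology.to_firstCountableTopology _ (generateFrom (subbasis X)) hsc) μ
    change Tendsto id (@nhds _ (generateFrom (subbasis X)) μ) (𝓝 μ)
    refine tendsto_of_forall_isOpen_le_liminf' (μ := μ) (μs := id) fun G hG => ?_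
    refine le_of_forall_lt fun r hr => ?_
    -- approximate `G` from below by a finite union of basic open sets
    let C : Set (Set X) := {B ∈ countableBasis X | B ⊆ G}
    have hCc : C.Countable := (countable_countableBasis X).mono fun _ h => h.1
    have hCG : ⋃₀ C = G := ((isBasis_countableBasis X).open_eq_sUnion' hG).symm
    have hfin : ∃ F : Set (Set X), F.Finite ∧ F ⊆ C ∧ r < (μ : Measure X) (⋃₀ F) := by
      rcases C.eq_empty_or_nonempty with h0 | hne
      · refine ⟨∅, finite_empty, empty_subset _, ?_⟩
        rw [← h0, hCG]; exact hr
      · obtain ⟨e, he⟩ := hCc.exists_eq_range hne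
        have hacc : Tendsto (fun n => (μ : Measure X) (accumulate e n)) atTop
            (𝓝 ((μ : Measure X) (⋃ n, e n))) := tendsto_measure_iUnion_accumulate
        have hU : (⋃ n, e n) = G := by rw [← sUnion_range, ← he, hCG]
        rw [hU] at hacc
        obtain ⟨n, hn⟩ := (hacc.eventually (lt_mem_nhds hr)).exists
        refine ⟨e '' Iic n, (finite_Iic n).image e, ?_, ?_⟩
        · rintro _ ⟨k, -, rfl⟩
          exact he ▸ mem_range_self k
        · rw [sUnion_image]
          exact hn
    obtain ⟨F, hFf, hFC, hrF⟩ := hfin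
    obtain ⟨q, -, hrq, hqF⟩ := ENNReal.lt_iff_exists_rat_btwn.mp hrF
    have hmem : {ν : ProbabilityMeasure X | ENNReal.ofReal q < (ν : Measure X) (⋃₀ F)} ∈
        @nhds _ (generateFrom (subbasis X)) μ :=
      @IsOpen.mem_nhds _ (generateFrom (subbasis X)) μ _
        (@isOpen_generateFrom_of_mem _ _ _
          (mem_subbasis.mpr ⟨F, ⟨hFf, fun _ h => (hFC h).1⟩, q, rfl⟩)) hqF
    refine lt_of_lt_of_le hrq (le_liminf_of_le (by isBoundedDefault) ?_)
    filter_upwards [hmem] with ν hν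
    exact hν.le.trans (measure_mono (sUnion_subset fun B hB => (hFC hB).2))

instance secondCountable (X : Type u) [TopologicalSpace X] [PseudoMetrizableSpace X]
    [SecondCountableTopology X] [MeasurableSpace X] [BorelSpace X] :
    SecondCountableTopology (ProbabilityMeasure X) :=
  ⟨⟨_, countable_subbasis X, eq_generateFrom X⟩⟩

/-- On a separable metrizable space, the `σ`-algebra generated by the evaluations is the Borel
`σ`-algebra of the weak topology. -/
instance borelSpace (X : Type u) [TopologicalSpace X] [PseudoMetrizableSpace X]
    [SecondCountableTopology X] [MeasurableSpace X] [BorelSpace X] :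
    BorelSpace (ProbabilityMeasure X) := by
  refine ⟨le_antisymm ?_ ?_⟩
  · have : @Measurable _ _ (borel (ProbabilityMeasure X)) _
        (id : ProbabilityMeasure X → ProbabilityMeasure X) := by
      refine @Measurable.subtype_mk _ _ (borel (ProbabilityMeasure X)) _ _ _ ?_ _
      exact Measure.measurable_of_measurable_coe _ fun A hA => measurable_eval hA
    simpa [Measurable] using! this
  · rw [borel_eq_generateFrom_of_subbasis (eq_generateFrom X)]
    refine MeasurableSpace.generateFrom_le fun U hU => ?_
    obtain ⟨F, ⟨-, hF⟩, q, rfl⟩ := mem_subbasis.mp hU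
    have hG : MeasurableSet (⋃₀ F) :=
      (isOpen_sUnion fun G hG => isOpen_of_mem_countableBasis (hF hG)).measurableSet
    exact measurableSet_lt measurable_const ((Measure.measurable_coe hG).comp measurable_subtype_coe)

end WeakTopology

/-! ### Conditional probability systems -/

/-- A family of conditioning events: a non-empty family of non-empty measurable sets. -/
structure IsConditioningFamily {X : Type u} [MeasurableSpace X] (ℬ : Set (Set X)) : Prop where
  nonempty : ℬ.Nonempty
  measurableSet : ∀ B ∈ ℬ, MeasurableSet B
  nonempty_of_mem : ∀ B ∈ ℬ, B.Nonempty

/-- An array of probability measures indexed by `ℬ` is a conditional probability system if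
`μ(B|B) = 1`, and the chain rule `μ(A|B) μ(B|C) = μ(A|C)` holds for `A ⊆ B ⊆ C`. -/
structure IsCPS {X : Type u} [MeasurableSpace X] (ℬ : Set (Set X))
    (μ : ℬ → ProbabilityMeasure X) : Prop where
  self : ∀ B : ℬ, (μ B : Measure X) B = 1
  chain : ∀ (A : Set X) (B C : ℬ), MeasurableSet A → A ⊆ B → (B : Set X) ⊆ C →
    (μ B : Measure X) A * (μ C : Measure X) B = (μ C : Measure X) A

/-- The set `Δ^ℬ(X)` of conditional probability systems on `(X, ℬ)`. -/
def CPS (X : Type u) [MeasurableSpace X] (ℬ : Set (Set X)) : Type u :=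
  {μ : ℬ → ProbabilityMeasure X // IsCPS ℬ μ}

namespace CPS

/-- `Δ^ℬ(X)` as a subspace of the product `Δ(X)^ℬ`, where `Δ(X)` carries the topology of weak
convergence. -/
instance {X : Type u} [TopologicalSpace X] [MeasurableSpace X] [OpensMeasurableSpace X]
    (ℬ : Set (Set X)) : TopologicalSpace (CPS X ℬ) :=
  inferInstanceAs (TopologicalSpace {μ : ℬ → ProbabilityMeasure X // IsCPS ℬ μ})

/-- `Δ^ℬ(X)` carries its Borel `σ`-algebra. -/
instance {X : Type u} [TopologicalSpace X] [MeasurableSpace X] [OpensMeasurableSpace X]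
    (ℬ : Set (Set X)) : MeasurableSpace (CPS X ℬ) := borel _

instance {X : Type u} [TopologicalSpace X] [MeasurableSpace X] [OpensMeasurableSpace X]
    (ℬ : Set (Set X)) : BorelSpace (CPS X ℬ) := ⟨rfl⟩

instance {X : Type u} [TopologicalSpace X] [PseudoMetrizableSpace X]
    [SecondCountableTopology X] [MeasurableSpace X] [BorelSpace X] (ℬ : Set (Set X))
    [Countable ℬ] : SecondCountableTopology (CPS X ℬ) :=
  (IsEmbedding.subtypeVal (p := fun μ : ℬ → ProbabilityMeasure X => IsCPS ℬ μ)).secondCountableTopology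

instance {X : Type u} [TopologicalSpace X] [PseudoMetrizableSpace X]
    [SecondCountableTopology X] [MeasurableSpace X] [BorelSpace X] (ℬ : Set (Set X))
    [Countable ℬ] : MetrizableSpace (CPS X ℬ) := by
  have : MetrizableSpace (ℬ → ProbabilityMeasure X) := metrizableSpace_of_t3_secondCountable _
  exact (IsEmbedding.subtypeVal
    (p := fun μ : ℬ → ProbabilityMeasure X => IsCPS ℬ μ)).metrizableSpace

/-- The pushforward-CPS map induced by a measurable `f : X → Y` with `f⁻¹(𝒞) = ℬ`:
it sends `μ` to the array `E ↦ μ(f⁻¹(E) | f⁻¹(C))`, `C ∈ 𝒞`. -/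
noncomputable def push {X : Type u} {Y : Type v} [MeasurableSpace X] [MeasurableSpace Y]
    {ℬ : Set (Set X)} {𝒞 : Set (Set Y)} (f : X → Y) (hf : Measurable f)
    (h𝒞 : ∀ C ∈ 𝒞, MeasurableSet C) (hfam : (fun C => f ⁻¹' C) '' 𝒞 = ℬ) (μ : CPS X ℬ) :
    CPS Y 𝒞 :=
  ⟨fun C => (μ.1 ⟨f ⁻¹' C, hfam ▸ mem_image_of_mem _ C.2⟩).map hf.aemeasurable, by
    refine ⟨fun C => ?_, fun A B C hA hAB hBC => ?_⟩
    · rw [ProbabilityMeasure.map_apply' _ _ (h𝒞 C C.2)]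
      exact μ.2.self ⟨f ⁻¹' C, hfam ▸ mem_image_of_mem _ C.2⟩
    · rw [ProbabilityMeasure.map_apply' _ _ hA, ProbabilityMeasure.map_apply' _ _ hA,
        ProbabilityMeasure.map_apply' _ _ (h𝒞 B B.2)]
      exact μ.2.chain (f ⁻¹' A) ⟨f ⁻¹' B, hfam ▸ mem_image_of_mem _ B.2⟩
        ⟨f ⁻¹' C, hfam ▸ mem_image_of_mem _ C.2⟩ (hf hA) (preimage_mono hAB)
        (preimage_mono hBC)⟩

theorem push_push {X : Type u} {Y : Type v} {Z : Type w} [MeasurableSpace X] [MeasurableSpace Y]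
    [MeasurableSpace Z] {ℬ : Set (Set X)} {𝒞 : Set (Set Y)} {𝒟 : Set (Set Z)}
    (f : X → Y) (hf : Measurable f) (h𝒞 : ∀ C ∈ 𝒞, MeasurableSet C)
    (hfam : (fun C => f ⁻¹' C) '' 𝒞 = ℬ)
    (g : Y → Z) (hg : Measurable g) (h𝒟 : ∀ D ∈ 𝒟, MeasurableSet D)
    (hgfam : (fun D => g ⁻¹' D) '' 𝒟 = 𝒞)
    (k : X → Z) (hk : Measurable k) (hkfam : (fun D => k ⁻¹' D) '' 𝒟 = ℬ)
    (hkfg : ∀ x, g (f x) = k x) (μ : CPS X ℬ) :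
    push g hg h𝒟 hgfam (push f hf h𝒞 hfam μ) = push k hk h𝒟 hkfam μ := by
  obtain rfl : k = g ∘ f := funext fun x => (hkfg x).symm
  apply Subtype.ext
  funext D
  apply Subtype.ext
  exact Measure.map_map hg hf

/-- The pushforward-CPS map induced by a Borel map into a separable space is Borel measurable. -/
theorem measurable_push {X : Type u} {Y : Type v} [TopologicalSpace X] [PseudoMetrizableSpace X]
    [MeasurableSpace X] [BorelSpace X] [TopologicalSpace Y] [PseudoMetrizableSpace Y]
    [SecondCountableTopology Y] [MeasurableSpace Y] [BorelSpace Y]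
    {ℬ : Set (Set X)} {𝒞 : Set (Set Y)} [Countable 𝒞] (f : X → Y) (hf : Measurable f)
    (h𝒞 : ∀ C ∈ 𝒞, MeasurableSet C) (hfam : (fun C => f ⁻¹' C) '' 𝒞 = ℬ) :
    Measurable (push f hf h𝒞 hfam) := by
  have hval : Measurable fun μ : CPS X ℬ => (push f hf h𝒞 hfam μ).1 := by
    refine measurable_pi_lambda _ fun C => Measurable.subtype_mk ?_
    refine Measure.measurable_of_measurable_coe _ fun A hA => ?_
    have hev : Continuous fun μ : CPS X ℬ =>
        μ.1 ⟨f ⁻¹' C, hfam ▸ mem_image_of_mem _ C.2⟩ :=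
      (continuous_apply _).comp continuous_subtype_val
    have hb : @Measurable _ _ _ (borel (ProbabilityMeasure X)) fun μ : CPS X ℬ =>
        μ.1 ⟨f ⁻¹' C, hfam ▸ mem_image_of_mem _ C.2⟩ :=
      hev.borel_measurable
    have h := (WeakTopology.measurable_eval (hf hA)).comp hb
    convert! h using 2 with μ
    exact Measure.map_apply hf hA
  refine measurable_of_isOpen fun U hU => ?_
  obtain ⟨V, hV, rfl⟩ := isOpen_induced_iff.mp hU
  exact hval hV.measurableSet

end CPS

/-! ### Conditioning events and type structures

The two players are indexed by `Bool`; the co-player of `i` is `!i`. -/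

/-- For each player, a countable family of conditioning events of the space `S` of primitive
uncertainty. -/
structure ConditioningFamilies (S : Type u) [MeasurableSpace S] where
  ev : Bool → Set (Set S)
  isConditioningFamily : ∀ i, IsConditioningFamily (ev i)
  countable : ∀ i, (ev i).Countable

/-- The cylinders `B × Y` in `X × Y` with `B ∈ ℬ`. -/
def cylinders {X : Type u} (ℬ : Set (Set X)) (Y : Type v) : Set (Set (X × Y)) :=
  (fun B => Prod.fst ⁻¹' B) '' ℬ

/-- A type structure based on `S` and the families `ℬ` of conditioning events: non-empty
metrizable type sets `T i`, and Borel measurable belief maps from `T i` to the CPSs on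
`S × T (!i)` with conditioning events `B × T (!i)`, `B ∈ ℬ i`. -/
structure TypeStructure {S : Type u} [TopologicalSpace S] [MetrizableSpace S] [SouslinSpace S]
    [MeasurableSpace S] [BorelSpace S] (ℬ : ConditioningFamilies S) where
  T : Bool → Type v
  [topologicalSpace : ∀ i, TopologicalSpace (T i)]
  [metrizableSpace : ∀ i, MetrizableSpace (T i)]
  [measurableSpace : ∀ i, MeasurableSpace (T i)]
  [borelSpace : ∀ i, BorelSpace (T i)]
  [nonempty : ∀ i, Nonempty (T i)]
  β : ∀ i, T i → CPS (S × T (!i)) (cylinders (ℬ.ev i) (T (!i)))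
  measurable_β : ∀ i, Measurable (β i)

attribute [instance] TypeStructure.topologicalSpace TypeStructure.metrizableSpace
  TypeStructure.measurableSpace TypeStructure.borelSpace TypeStructure.nonempty

/-! ### The canonical spaces of hierarchies -/

/-- The data of the `n`-th step of the construction of the spaces of hierarchies. -/
structure HierarchyStep (S : Type u) [MeasurableSpace S] where
  /-- The domain of uncertainty `Θ_i^n`. -/
  Dom : Bool → Type u
  [domTop : ∀ i, TopologicalSpace (Dom i)]
  [domMetrizable : ∀ i, MetrizableSpace (Dom i)]
  [domSecondCountable : ∀ i, SecondCountableTopology (Dom i)]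
  [domMeas : ∀ i, MeasurableSpace (Dom i)]
  [domBorel : ∀ i, BorelSpace (Dom i)]
  /-- The family `ℬ_i^n` of conditioning events of `Θ_i^n`. -/
  fam : ∀ i, Set (Set (Dom i))
  fam_measurable : ∀ i, ∀ B ∈ fam i, MeasurableSet B
  [fam_countable : ∀ i, Countable (fam i)]
  /-- The set `H_i^{n+1}` of coherent tuples `(μ^1, …, μ^{n+1})`. -/
  H : Bool → Type u
  [hTop : ∀ i, TopologicalSpace (H i)]
  [hMetrizable : ∀ i, MetrizableSpace (H i)]
  [hSecondCountable : ∀ i, SecondCountableTopology (H i)]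
  [hMeas : ∀ i, MeasurableSpace (H i)]
  [hBorel : ∀ i, BorelSpace (H i)]
  /-- The last entry `μ^{n+1}` of a tuple in `H_i^{n+1}`. -/
  last : ∀ i, H i → CPS (Dom i) (fam i)
  /-- The projection `ρ_i^{n,n+1}` from `Θ_i^{n+1} = S × H_j^{n+1}` to `Θ_i^n`. -/
  proj : ∀ i, S × H (!i) → Dom i
  measurable_proj : ∀ i, Measurable (proj i)

attribute [instance] HierarchyStep.domTop HierarchyStep.domMetrizable
  HierarchyStep.domSecondCountable HierarchyStep.domMeas HierarchyStep.domBorel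
  HierarchyStep.fam_countable HierarchyStep.hTop HierarchyStep.hMetrizable
  HierarchyStep.hSecondCountable HierarchyStep.hMeas HierarchyStep.hBorel

namespace HierarchyStep

/-- The initial step: `Θ_i^0 = S`, `ℬ_i^0 = ℬ_i` and `H_i^1 = Δ^{ℬ_i}(S)`. -/
noncomputable def zero {S : Type u} [TopologicalSpace S] [MetrizableSpace S] [SouslinSpace S]
    [MeasurableSpace S] [BorelSpace S] (ℬ : ConditioningFamilies S) : HierarchyStep S :=
  have _ : ∀ i, Countable (ℬ.ev i) := fun i => (ℬ.countable i).to_subtype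
  { Dom := fun _ => S
    fam := ℬ.ev
    fam_measurable := fun i => (ℬ.isConditioningFamily i).measurableSet
    H := fun i => CPS S (ℬ.ev i)
    last := fun _ μ => μ
    proj := fun _ => Prod.fst
    measurable_proj := fun _ => measurable_fst }

/-- The family `ℬ_i^{n+1} = (ρ_i^{n,n+1})⁻¹(ℬ_i^n)` of conditioning events of
`Θ_i^{n+1} = S × H_j^{n+1}`. -/
def nextFam {S : Type u} [MeasurableSpace S] (L : HierarchyStep S) (i : Bool) :
    Set (Set (S × L.H (!i))) :=
  (fun B => L.proj i ⁻¹' B) '' L.fam i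

/-- The set `H_i^{n+2}` of those pairs in `H_i^{n+1} × Δ^{ℬ_i^{n+1}}(Θ_i^{n+1})` whose second
entry has the last CPS of the first entry as its marginal on `Θ_i^n`. -/
def NextH {S : Type u} [TopologicalSpace S] [MetrizableSpace S] [SouslinSpace S]
    [MeasurableSpace S] [BorelSpace S] (L : HierarchyStep S) (i : Bool) : Type u :=
  {p : L.H i × CPS (S × L.H (!i)) (L.nextFam i) //
    CPS.push (L.proj i) (L.measurable_proj i) (L.fam_measurable i) rfl p.2 = L.last i p.1}

theorem nextFam_measurable {S : Type u} [MeasurableSpace S] (L : HierarchyStep S) (i : Bool) :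
    ∀ B ∈ L.nextFam i, MeasurableSet B := by
  rintro _ ⟨B, hB, rfl⟩
  exact L.measurable_proj i (L.fam_measurable i B hB)

instance {S : Type u} [MeasurableSpace S] (L : HierarchyStep S) (i : Bool) :
    Countable (L.nextFam i) :=
  (((L.fam i).to_countable).image _).to_subtype

instance {S : Type u} [TopologicalSpace S] [MetrizableSpace S] [SouslinSpace S]
    [MeasurableSpace S] [BorelSpace S] (L : HierarchyStep S) (i : Bool) : TopologicalSpace (L.NextH i) :=
  instTopologicalSpaceSubtype

instance {S : Type u} [TopologicalSpace S] [MetrizableSpace S] [SouslinSpace S]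
    [MeasurableSpace S] [BorelSpace S] (L : HierarchyStep S) (i : Bool) : MetrizableSpace (L.NextH i) :=
  (IsEmbedding.subtypeVal (p := fun p : L.H i × CPS (S × L.H (!i)) (L.nextFam i) =>
    CPS.push (L.proj i) (L.measurable_proj i) (L.fam_measurable i) rfl p.2 =
      L.last i p.1)).metrizableSpace

instance {S : Type u} [TopologicalSpace S] [MetrizableSpace S] [SouslinSpace S]
    [MeasurableSpace S] [BorelSpace S] (L : HierarchyStep S) (i : Bool) : SecondCountableTopology (L.NextH i) :=
  (IsEmbedding.subtypeVal (p := fun p : L.H i × CPS (S × L.H (!i)) (L.nextFam i) =>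
    CPS.push (L.proj i) (L.measurable_proj i) (L.fam_measurable i) rfl p.2 =
      L.last i p.1)).secondCountableTopology

instance {S : Type u} [TopologicalSpace S] [MetrizableSpace S] [SouslinSpace S]
    [MeasurableSpace S] [BorelSpace S] (L : HierarchyStep S) (i : Bool) : MeasurableSpace (L.NextH i) := borel _

instance {S : Type u} [TopologicalSpace S] [MetrizableSpace S] [SouslinSpace S]
    [MeasurableSpace S] [BorelSpace S] (L : HierarchyStep S) (i : Bool) : BorelSpace (L.NextH i) := ⟨rfl⟩

/-- The first entry `π_i^{n+1,n+2} : H_i^{n+2} → H_i^{n+1}`. -/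
def NextH.init {S : Type u} [TopologicalSpace S] [MetrizableSpace S] [SouslinSpace S]
    [MeasurableSpace S] [BorelSpace S] {L : HierarchyStep S} {i : Bool} (x : L.NextH i) : L.H i := x.1.1

/-- The last entry of a tuple in `H_i^{n+2}`. -/
def NextH.last {S : Type u} [TopologicalSpace S] [MetrizableSpace S] [SouslinSpace S]
    [MeasurableSpace S] [BorelSpace S] {L : HierarchyStep S} {i : Bool} (x : L.NextH i) :
    CPS (S × L.H (!i)) (L.nextFam i) := x.1.2

theorem NextH.continuous_init {S : Type u} [TopologicalSpace S] [MetrizableSpace S] [SouslinSpace S]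
    [MeasurableSpace S] [BorelSpace S] (L : HierarchyStep S) (i : Bool) :
    Continuous (NextH.init : L.NextH i → L.H i) :=
  continuous_fst.comp continuous_subtype_val

/-- The inductive step: `Θ_i^{n+1} = S × H_j^{n+1}`, with the families `ℬ_i^{n+1}` and the sets
`H_i^{n+2}` just defined, and `ρ_i^{n+1,n+2} = (Id, π_j^{n+1,n+2})`. -/
noncomputable def next {S : Type u} [TopologicalSpace S] [MetrizableSpace S] [SouslinSpace S]
    [MeasurableSpace S] [BorelSpace S] (L : HierarchyStep S) : HierarchyStep S where
  Dom := fun i => S × L.H (!i)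
  fam := L.nextFam
  fam_measurable := L.nextFam_measurable
  H := L.NextH
  last := fun _ x => x.last
  proj := fun _ p => (p.1, p.2.init)
  measurable_proj := fun i => measurable_fst.prodMk
    ((NextH.continuous_init L (!i)).measurable.comp measurable_snd)

end HierarchyStep

/-- The `n`-th step of the construction of the spaces of hierarchies. -/
noncomputable def hierarchyStep {S : Type u} [TopologicalSpace S] [MetrizableSpace S] [SouslinSpace S]
    [MeasurableSpace S] [BorelSpace S] (ℬ : ConditioningFamilies S) : ℕ → HierarchyStep S
  | 0 => HierarchyStep.zero ℬ
  | n + 1 => (hierarchyStep ℬ n).next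

namespace ConditioningFamilies

/-- `ℬ.Theta i n` is player `i`'s domain of uncertainty `Θ_i^n` of order `n + 1`. -/
abbrev Theta {S : Type u} [TopologicalSpace S] [MetrizableSpace S] [SouslinSpace S]
    [MeasurableSpace S] [BorelSpace S] (ℬ : ConditioningFamilies S) (i : Bool) (n : ℕ) : Type u :=
  (hierarchyStep ℬ n).Dom i

/-- `ℬ.thetaFam i n` is the family `ℬ_i^n` of conditioning events of `Θ_i^n`. -/
abbrev thetaFam {S : Type u} [TopologicalSpace S] [MetrizableSpace S] [SouslinSpace S]
    [MeasurableSpace S] [BorelSpace S] (ℬ : ConditioningFamilies S) (i : Bool) (n : ℕ) : Set (Set (ℬ.Theta i n)) :=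
  (hierarchyStep ℬ n).fam i

/-- `ℬ.FiniteHierarchy i n` is the set `H_i^{n+1}` of player `i`'s coherent hierarchies
`(μ^1, …, μ^{n+1})` of order `n + 1`. -/
abbrev FiniteHierarchy {S : Type u} [TopologicalSpace S] [MetrizableSpace S] [SouslinSpace S]
    [MeasurableSpace S] [BorelSpace S] (ℬ : ConditioningFamilies S) (i : Bool) (n : ℕ) : Type u :=
  (hierarchyStep ℬ n).H i

/-- The entry `μ^{n+1}` of a tuple `(μ^1, …, μ^{n+1})` in `H_i^{n+1}`. -/
noncomputable def lastEntry {S : Type u} [TopologicalSpace S] [MetrizableSpace S] [SouslinSpace S]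
    [MeasurableSpace S] [BorelSpace S] (ℬ : ConditioningFamilies S) (i : Bool) (n : ℕ) (x : ℬ.FiniteHierarchy i n) :
    CPS (ℬ.Theta i n) (ℬ.thetaFam i n) :=
  (hierarchyStep ℬ n).last i x

/-- The coordinate projection `π_i^{n+1,n+2} : H_i^{n+2} → H_i^{n+1}`, deleting the last entry. -/
noncomputable def truncate {S : Type u} [TopologicalSpace S] [MetrizableSpace S] [SouslinSpace S]
    [MeasurableSpace S] [BorelSpace S] (ℬ : ConditioningFamilies S) (i : Bool) (n : ℕ)
    (x : ℬ.FiniteHierarchy i (n + 1)) : ℬ.FiniteHierarchy i n :=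
  HierarchyStep.NextH.init x

/-- The set `H_i` of player `i`'s collectively coherent hierarchies: the sequences
`(μ^1, μ^2, …)` of CPSs on `Θ_i^0, Θ_i^1, …` all of whose initial segments
`x n = (μ^1, …, μ^{n+1})` belong to `H_i^{n+1}`. Here `μ n` stands for `μ^{n+1}`. -/
def Hierarchies {S : Type u} [TopologicalSpace S] [MetrizableSpace S] [SouslinSpace S]
    [MeasurableSpace S] [BorelSpace S] (ℬ : ConditioningFamilies S) (i : Bool) :
    Set (∀ n, CPS (ℬ.Theta i n) (ℬ.thetaFam i n)) :=
  {μ | ∃ x : ∀ n, ℬ.FiniteHierarchy i n,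
    (∀ n, ℬ.truncate i n (x (n + 1)) = x n) ∧ ∀ n, ℬ.lastEntry i n (x n) = μ n}

end ConditioningFamilies

/-! ### The hierarchies generated by types -/

namespace TypeStructure

/-- The `n`-th step of the construction of the hierarchy maps of a type structure: the maps
`h_{-i}^n : S × T_j → Θ_i^n` and `h_i^{n+1} : T_i → H_i^{n+1}`. -/
structure HierarchyMaps {S : Type u} [TopologicalSpace S] [MetrizableSpace S] [SouslinSpace S]
    [MeasurableSpace S] [BorelSpace S] {ℬ : ConditioningFamilies S} (𝒯 : TypeStructure.{u, v} ℬ)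
    (L : HierarchyStep S) where
  toDom : ∀ i, S × 𝒯.T (!i) → L.Dom i
  measurable_toDom : ∀ i, Measurable (toDom i)
  preimage_fam : ∀ i, (fun B => toDom i ⁻¹' B) '' L.fam i = cylinders (ℬ.ev i) (𝒯.T (!i))
  h : ∀ i, 𝒯.T i → L.H i
  measurable_h : ∀ i, Measurable (h i)
  last_h : ∀ i t, L.last i (h i t) =
    CPS.push (toDom i) (measurable_toDom i) (L.fam_measurable i) (preimage_fam i) (𝒯.β i t)
  proj_h : ∀ i s t, L.proj i (s, h (!i) t) = toDom i (s, t)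

namespace HierarchyMaps

/-- The initial step: `h_{-i}^0` is the projection to `S`, and `h_i^1(t)` is the marginal of
`β_i(t)` on `S`. -/
noncomputable def zero {S : Type u} [TopologicalSpace S] [MetrizableSpace S] [SouslinSpace S]
    [MeasurableSpace S] [BorelSpace S] {ℬ : ConditioningFamilies S} (𝒯 : TypeStructure.{u, v} ℬ) :
    𝒯.HierarchyMaps (HierarchyStep.zero ℬ) :=
  have _ : ∀ i, Countable (ℬ.ev i) := fun i => (ℬ.countable i).to_subtype
  { toDom := fun _ => Prod.fst
    measurable_toDom := fun _ => measurable_fst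
    preimage_fam := fun _ => rfl
    h := fun i t => CPS.push Prod.fst measurable_fst
      (ℬ.isConditioningFamily i).measurableSet rfl (𝒯.β i t)
    measurable_h := fun i => (CPS.measurable_push Prod.fst measurable_fst
      (ℬ.isConditioningFamily i).measurableSet rfl).comp (𝒯.measurable_β i)
    last_h := fun _ _ => rfl
    proj_h := fun _ _ _ => rfl }

/-- The map `h_{-i}^{n+1} = (Id, h_j^{n+1}) : S × T_j → S × H_j^{n+1}`. -/
def nextDom {S : Type u} [TopologicalSpace S] [MetrizableSpace S] [SouslinSpace S]
    [MeasurableSpace S] [BorelSpace S] {ℬ : ConditioningFamilies S} {𝒯 : TypeStructure.{u, v} ℬ} {L : HierarchyStep S}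
    (M : 𝒯.HierarchyMaps L) (i : Bool) (p : S × 𝒯.T (!i)) : S × L.H (!i) :=
  (p.1, M.h (!i) p.2)

theorem measurable_nextDom {S : Type u} [TopologicalSpace S] [MetrizableSpace S] [SouslinSpace S]
    [MeasurableSpace S] [BorelSpace S] {ℬ : ConditioningFamilies S} {𝒯 : TypeStructure.{u, v} ℬ}
    {L : HierarchyStep S} (M : 𝒯.HierarchyMaps L) (i : Bool) : Measurable (M.nextDom i) :=
  measurable_fst.prodMk ((M.measurable_h (!i)).comp measurable_snd)

theorem proj_nextDom {S : Type u} [TopologicalSpace S] [MetrizableSpace S] [SouslinSpace S]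
    [MeasurableSpace S] [BorelSpace S] {ℬ : ConditioningFamilies S} {𝒯 : TypeStructure.{u, v} ℬ}
    {L : HierarchyStep S} (M : 𝒯.HierarchyMaps L) (i : Bool) (p : S × 𝒯.T (!i)) :
    L.proj i (M.nextDom i p) = M.toDom i p :=
  M.proj_h i p.1 p.2

theorem preimage_nextFam {S : Type u} [TopologicalSpace S] [MetrizableSpace S] [SouslinSpace S]
    [MeasurableSpace S] [BorelSpace S] {ℬ : ConditioningFamilies S} {𝒯 : TypeStructure.{u, v} ℬ}
    {L : HierarchyStep S} (M : 𝒯.HierarchyMaps L) (i : Bool) :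
    (fun B => M.nextDom i ⁻¹' B) '' L.nextFam i = cylinders (ℬ.ev i) (𝒯.T (!i)) := by
  rw [← M.preimage_fam i, HierarchyStep.nextFam, image_image]
  refine image_congr fun B _ => ?_
  ext p
  simp only [mem_preimage, proj_nextDom]

/-- The map `h_i^{n+2}(t) = (h_i^{n+1}(t), μ)`, where `μ` is the image of `β_i(t)` under
`h_{-i}^{n+1}`. -/
noncomputable def nextH {S : Type u} [TopologicalSpace S] [MetrizableSpace S] [SouslinSpace S]
    [MeasurableSpace S] [BorelSpace S] {ℬ : ConditioningFamilies S} {𝒯 : TypeStructure.{u, v} ℬ}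
    {L : HierarchyStep S} (M : 𝒯.HierarchyMaps L) (i : Bool) (t : 𝒯.T i) : L.NextH i :=
  ⟨(M.h i t, CPS.push (M.nextDom i) (M.measurable_nextDom i) (L.nextFam_measurable i)
      (M.preimage_nextFam i) (𝒯.β i t)),
    (CPS.push_push _ (M.measurable_nextDom i) (L.nextFam_measurable i) (M.preimage_nextFam i)
      _ _ _ _ _ (M.measurable_toDom i) (M.preimage_fam i)
      (M.proj_nextDom i) _).trans (M.last_h i t).symm⟩

theorem measurable_nextH {S : Type u} [TopologicalSpace S] [MetrizableSpace S] [SouslinSpace S]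
    [MeasurableSpace S] [BorelSpace S] {ℬ : ConditioningFamilies S} {𝒯 : TypeStructure.{u, v} ℬ}
    {L : HierarchyStep S} (M : 𝒯.HierarchyMaps L) (i : Bool) : Measurable (M.nextH i) := by
  have hval : Measurable fun t => (M.nextH i t).1 :=
    (M.measurable_h i).prodMk ((CPS.measurable_push (M.nextDom i) (M.measurable_nextDom i)
      (L.nextFam_measurable i) (M.preimage_nextFam i)).comp (𝒯.measurable_β i))
  refine measurable_of_isOpen fun U hU => ?_
  obtain ⟨V, hV, rfl⟩ := isOpen_induced_iff.mp hU
  exact hval hV.measurableSet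

/-- The inductive step. -/
noncomputable def next {S : Type u} [TopologicalSpace S] [MetrizableSpace S] [SouslinSpace S]
    [MeasurableSpace S] [BorelSpace S] {ℬ : ConditioningFamilies S} {𝒯 : TypeStructure.{u, v} ℬ}
    {L : HierarchyStep S} (M : 𝒯.HierarchyMaps L) : 𝒯.HierarchyMaps L.next where
  toDom := M.nextDom
  measurable_toDom := M.measurable_nextDom
  preimage_fam := M.preimage_nextFam
  h := M.nextH
  measurable_h := M.measurable_nextH
  last_h := fun _ _ => rfl
  proj_h := fun _ _ _ => rfl

end HierarchyMaps

/-- The `n`-th step of the construction of the hierarchy maps. -/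
noncomputable def hierarchyMaps {S : Type u} [TopologicalSpace S] [MetrizableSpace S] [SouslinSpace S]
    [MeasurableSpace S] [BorelSpace S] {ℬ : ConditioningFamilies S} (𝒯 : TypeStructure.{u, v} ℬ) :
    ∀ n, 𝒯.HierarchyMaps (hierarchyStep ℬ n)
  | 0 => HierarchyMaps.zero 𝒯
  | n + 1 => (𝒯.hierarchyMaps n).next

/-- The hierarchy `h_i^{n+1}(t)` of order `n + 1` generated by the type `t`. -/
noncomputable def finiteHierarchy {S : Type u} [TopologicalSpace S] [MetrizableSpace S] [SouslinSpace S]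
    [MeasurableSpace S] [BorelSpace S] {ℬ : ConditioningFamilies S} (𝒯 : TypeStructure.{u, v} ℬ)
    (i : Bool) (n : ℕ) (t : 𝒯.T i) : ℬ.FiniteHierarchy i n :=
  (𝒯.hierarchyMaps n).h i t

/-- The infinite hierarchy `h_i(t)` generated by the type `t`: the sequence of the images of
`β_i(t)` under the maps `h_{-i}^n`, `n ≥ 0`. -/
noncomputable def hierarchy {S : Type u} [TopologicalSpace S] [MetrizableSpace S] [SouslinSpace S]
    [MeasurableSpace S] [BorelSpace S] {ℬ : ConditioningFamilies S} (𝒯 : TypeStructure.{u, v} ℬ)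
    (i : Bool) (t : 𝒯.T i) : ∀ n, CPS (ℬ.Theta i n) (ℬ.thetaFam i n) := fun n =>
  CPS.push ((𝒯.hierarchyMaps n).toDom i) ((𝒯.hierarchyMaps n).measurable_toDom i)
    ((hierarchyStep ℬ n).fam_measurable i) ((𝒯.hierarchyMaps n).preimage_fam i) (𝒯.β i t)

/-! ### Properties of type structures -/

/-- Every type set is a Souslin space. -/
def Souslin {S : Type u} [TopologicalSpace S] [MetrizableSpace S] [SouslinSpace S]
    [MeasurableSpace S] [BorelSpace S] {ℬ : ConditioningFamilies S} (𝒯 : TypeStructure.{u, v} ℬ) : Prop :=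
  ∀ i, SouslinSpace (𝒯.T i)

/-- Every type set is compact. -/
def Compact {S : Type u} [TopologicalSpace S] [MetrizableSpace S] [SouslinSpace S]
    [MeasurableSpace S] [BorelSpace S] {ℬ : ConditioningFamilies S} (𝒯 : TypeStructure.{u, v} ℬ) : Prop :=
  ∀ i, CompactSpace (𝒯.T i)

/-- Every belief map is continuous. -/
def IsContinuous {S : Type u} [TopologicalSpace S] [MetrizableSpace S] [SouslinSpace S]
    [MeasurableSpace S] [BorelSpace S] {ℬ : ConditioningFamilies S} (𝒯 : TypeStructure.{u, v} ℬ) : Prop :=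
  ∀ i, Continuous (𝒯.β i)

/-- Every belief map is surjective. -/
def Complete {S : Type u} [TopologicalSpace S] [MetrizableSpace S] [SouslinSpace S]
    [MeasurableSpace S] [BorelSpace S] {ℬ : ConditioningFamilies S} (𝒯 : TypeStructure.{u, v} ℬ) : Prop :=
  ∀ i, Function.Surjective (𝒯.β i)

/-- For every type in any type structure and every order, some type of `𝒯` generates the same
hierarchy up to that order. -/
def FinitelyTerminal {S : Type u} [TopologicalSpace S] [MetrizableSpace S] [SouslinSpace S]
    [MeasurableSpace S] [BorelSpace S] {ℬ : ConditioningFamilies S} (𝒯 : TypeStructure.{u, v} ℬ) : Prop :=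
  ∀ (𝒯' : TypeStructure.{u, w} ℬ) (i : Bool) (t' : 𝒯'.T i) (n : ℕ),
    ∃ t : 𝒯.T i, 𝒯'.finiteHierarchy i n t' = 𝒯.finiteHierarchy i n t

/-- For every type in any type structure, some type of `𝒯` generates the same infinite
hierarchy. -/
def Terminal {S : Type u} [TopologicalSpace S] [MetrizableSpace S] [SouslinSpace S]
    [MeasurableSpace S] [BorelSpace S] {ℬ : ConditioningFamilies S} (𝒯 : TypeStructure.{u, v} ℬ) : Prop :=
  ∀ (𝒯' : TypeStructure.{u, w} ℬ) (i : Bool) (t' : 𝒯'.T i),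
    ∃ t : 𝒯.T i, 𝒯'.hierarchy i t' = 𝒯.hierarchy i t

end TypeStructure

/-! ### Measurable sections almost everywhere -/

/-! Everything rests on lifting conditional probability systems: if `f` is a Borel map of a Souslin
space onto a separable metrizable space, every CPS on the target is the pushforward of one on the
source (`CPS.push_surjective`). For a single measure one pushes it forward along a Borel section of
`f` defined almost everywhere. Since there are countably many conditioning events, one finite
measure dominates the whole array, so one section serves all of its members at once, and the chain
rule survives the lifting.

The section comes from compactness. Over a compact set a continuous map has a Borel section that
picks the least point of each fibre. A capacity argument on the Baire space exhausts a finite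
measure on the range by images of compact sets.

For (i), induct on the order for both players simultaneously. If `h_j^n` is onto, so is `(Id,
h_j^n)`. The last entry of a coherent tuple then lifts to a CPS on `S × T_j`, which completeness
turns into a belief of some type. The last entry determines the tuple, so this type generates it.

For (ii), the types generating a prescribed initial segment form a non-empty closed set, by (i) and
continuity. These sets decrease with the order, so compactness gives a type in all of them. Both
forms of terminality follow because hierarchies generated in any type structure are coherent. -/

/-- A continuous map on the Cantor space has a Borel section over its range. -/
theorem exists_measurable_section_of_cantor {Y : Type u} [TopologicalSpace Y] [T2Space Y]
    [MeasurableSpace Y] [OpensMeasurableSpace Y] (G : (ℕ → Bool) → Y) (hG : Continuous G) :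
    ∃ g : Y → (ℕ → Bool), Measurable g ∧ ∀ y ∈ range G, G (g y) = y := by
  classical
  -- The embedding as the ternary Cantor set gives a real-valued continuous injection; minimizing it
  -- selects a single point in each compact fibre.
  let e : (ℕ → Bool) → ℝ := fun x => cantorSetHomeomorphNatToBool.symm x
  have he : Continuous e := continuous_subtype_val.comp (Homeomorph.continuous _)
  have hinj : Function.Injective e := Subtype.val_injective.comp (Homeomorph.injective _)
  have hemb : MeasurableEmbedding e := (he.isClosedEmbedding hinj).measurableEmbedding
  have hmin : ∀ y : Y, ∃ x, (y ∈ range G → G x = y ∧ ∀ z, G z = y → e x ≤ e z) ∧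
      (y ∉ range G → x = fun _ => false) := by
    intro y
    by_cases hy : y ∈ range G
    · obtain ⟨x0, hx0⟩ := hy
      have hc : IsCompact (G ⁻¹' {y}) := (isClosed_singleton.preimage hG).isCompact
      obtain ⟨x, hx, hmin⟩ := hc.exists_isMinOn ⟨x0, hx0⟩ he.continuousOn
      exact ⟨x, fun _ => ⟨hx, fun z hz => hmin hz⟩, fun h => (h ⟨x0, hx0⟩).elim⟩
    · exact ⟨_, fun h => (hy h).elim, fun _ => rfl⟩
  choose g hg hg' using hmin
  refine ⟨g, ?_, fun y hy => (hg y hy).1⟩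
  refine hemb.measurable_comp_iff.mp (measurable_of_Iic fun c => ?_)
  -- The minimum of `e` over a fibre is at most `c` exactly when the fibre meets the compact set `e
  -- ⁻¹' Iic c`. Off the range `g` is constant, so that part is either empty or the whole
  -- complement.
  have hset : (e ∘ g) ⁻¹' Iic c = G '' (e ⁻¹' Iic c) ∪
      ((range G)ᶜ ∩ {_y | e (fun _ => false) ≤ c}) := by
    ext y
    by_cases hy : y ∈ range G
    · simp only [mem_preimage, Function.comp_apply, mem_Iic, mem_union, mem_image, mem_inter_iff,
        mem_compl_iff, hy, not_true_eq_false, false_and, or_false]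
      exact ⟨fun h => ⟨g y, h, (hg y hy).1⟩, fun ⟨x, hx, hxy⟩ => ((hg y hy).2 x hxy).trans hx⟩
    · simp only [mem_preimage, Function.comp_apply, mem_Iic, mem_union, mem_inter_iff,
        mem_compl_iff, hy, not_false_eq_true, true_and, mem_ofPred_eq, hg' y hy]
      exact ⟨Or.inr, fun h => h.elim (fun ⟨x, _, hx⟩ => (hy ⟨x, hx⟩).elim) id⟩
  rw [hset]
  have hcl : IsClosed (G '' (e ⁻¹' Iic c)) :=
    ((isClosed_Iic.preimage he).isCompact.image hG).isClosed
  exact hcl.measurableSet.union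
    ((isCompact_range hG).isClosed.measurableSet.compl.inter (MeasurableSet.const _))

/-- A continuous map on a compact metrizable space has a Borel section over its range. -/
theorem exists_measurable_section_of_isCompact {X : Type v} {Y : Type u} [TopologicalSpace X]
    [MetrizableSpace X] [MeasurableSpace X] [BorelSpace X] [TopologicalSpace Y] [T2Space Y]
    [MeasurableSpace Y] [OpensMeasurableSpace Y] {F : X → Y} (hF : Continuous F) {K : Set X}
    (hK : IsCompact K) (hne : K.Nonempty) :
    ∃ g : Y → X, Measurable g ∧ ∀ y ∈ F '' K, F (g y) = y := by
  let _ := metrizableSpaceMetric X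
  have : CompactSpace K := isCompact_iff_compactSpace.mp hK
  have : Nonempty K := hne.to_subtype
  obtain ⟨φ, hφ, hs⟩ := exists_nat_bool_continuous_surjective_of_compact K
  have hφ' : Continuous fun x => (φ x : X) := continuous_subtype_val.comp hφ
  obtain ⟨g, hg, hsec⟩ := exists_measurable_section_of_cantor _ (hF.comp hφ')
  refine ⟨fun y => φ (g y), hφ'.measurable.comp hg, ?_⟩
  rintro _ ⟨x, hx, rfl⟩
  obtain ⟨z, hz⟩ := hs ⟨x, hx⟩
  exact hsec _ ⟨z, by simp [hz]⟩

/-- The image of the Baire space under a continuous map contains compact images of compact sets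
of measure as large as desired. -/
theorem exists_isCompact_le_measure_image {Y : Type u} [TopologicalSpace Y] [MeasurableSpace Y]
    {F : (ℕ → ℕ) → Y} (hF : Continuous F) (m : Measure Y) [m.OuterRegular] {c : ℝ≥0∞}
    (hc : c < m (range F)) : ∃ K, IsCompact K ∧ c ≤ m (F '' K) := by
  -- Continuity from below along increasing sequences holds for arbitrary sets, so the images need
  -- not be known to be measurable. Bounding one more coordinate keeps the outer measure above `c`.
  have hstep : ∀ (k : ℕ) (A : {A : Set (ℕ → ℕ) // c < m (F '' A)}),
      ∃ n : ℕ, c < m (F '' (A.1 ∩ {x | x k ≤ n})) := by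
    intro k A
    have hmono : Monotone fun n : ℕ => F '' (A.1 ∩ {x | x k ≤ n}) := fun a b hab =>
      image_mono (inter_subset_inter_right _ fun x (hx : x k ≤ a) => hx.trans hab)
    have hU : (⋃ n : ℕ, F '' (A.1 ∩ {x | x k ≤ n})) = F '' A.1 := by
      rw [← image_iUnion, ← inter_iUnion]
      congr 1
      exact inter_eq_left.mpr fun x _ => mem_iUnion.mpr ⟨x k, le_refl (x k)⟩
    have h := A.2
    rw [← hU, hmono.measure_iUnion] at h
    exact lt_iSup_iff.mp h
  choose n hn using hstep
  let A : ℕ → {A : Set (ℕ → ℕ) // c < m (F '' A)} := fun k =>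
    Nat.rec ⟨univ, by rwa [image_univ]⟩ (fun k A => ⟨A.1 ∩ {x | x k ≤ n k A}, hn k A⟩) k
  let s : ℕ → ℕ := fun k => n k (A k)
  have hA : ∀ k, ∀ x ∈ (A k).1, ∀ i < k, x i ≤ s i := by
    intro k
    induction k with
    | zero => intro x _ i hi; omega
    | succ k ih =>
      rintro x ⟨hx, hxk⟩ i hi
      rcases Nat.lt_succ_iff_lt_or_eq.mp hi with h | rfl
      · exact ih x hx i h
      · exact hxk
  -- Bounding all coordinates gives a compact set. Measure need not be continuous along the
  -- decreasing images of the `A k`, so outer regularity replaces that step: an open set around `F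
  -- '' K` already contains some `F '' A N`.
  let K : Set (ℕ → ℕ) := univ.pi fun i => Iic (s i)
  have hK : IsCompact K := isCompact_univ_pi fun i => (finite_Iic _).isCompact
  refine ⟨K, hK, ?_⟩
  by_contra! hlt
  obtain ⟨U, hKU, hUo, hUc⟩ := Set.exists_isOpen_lt_of_lt _ _ hlt
  let _ : MetricSpace (ℕ → ℕ) := PiNat.metricSpaceNatNat
  obtain ⟨δ, hδ, hsub⟩ := hK.exists_thickening_subset_open (hUo.preimage hF)
    (image_subset_iff.mp hKU)
  obtain ⟨N, hN⟩ := exists_pow_lt_of_lt_one hδ (by norm_num : (1 / 2 : ℝ) < 1)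
  have hAU : F '' (A N).1 ⊆ U := by
    rintro _ ⟨y, hy, rfl⟩
    -- Truncating `y` coordinatewise by `s` gives a point of `K` that agrees with `y` in the first
    -- `N` coordinates, hence lies within `(1 / 2) ^ N < δ` of it.
    refine hsub (Metric.mem_thickening_iff.mpr ⟨fun i => min (y i) (s i),
      fun i _ => mem_Iic.mpr (min_le_right _ _), lt_of_le_of_lt ?_ hN⟩)
    refine PiNat.mem_cylinder_iff_dist_le.mp fun i hi => ?_
    exact (min_eq_left (hA N y hy i hi)).symm
  exact lt_asymm ((A N).2.trans_le (measure_mono hAU)) hUc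

/-- A continuous map of the Baire space onto a metrizable space has a Borel section almost
everywhere for any finite measure. -/
theorem exists_ae_section_of_baire {Y : Type u} [TopologicalSpace Y] [MetrizableSpace Y]
    [MeasurableSpace Y] [BorelSpace Y] {F : (ℕ → ℕ) → Y} (hF : Continuous F)
    (hs : Function.Surjective F) (m : Measure Y) [IsFiniteMeasure m] :
    ∃ g : Y → (ℕ → ℕ), Measurable g ∧ ∀ᵐ y ∂m, F (g y) = y := by
  classical
  rcases eq_or_ne m 0 with rfl | hm
  · exact ⟨fun _ _ => 0, measurable_const, by simp⟩
  have h0 : m univ ≠ 0 := by simpa using hm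
  obtain ⟨c, -, hc, hclim⟩ := exists_seq_strictMono_tendsto' (pos_iff_ne_zero.mpr h0)
  have hex : ∀ k, ∃ K, IsCompact K ∧ c k ≤ m (F '' K) := fun k =>
    exists_isCompact_le_measure_image hF m (by rw [hs.range_eq]; exact (hc k).2)
  choose K hK hcK using hex
  have hne : ∀ k, (K k).Nonempty := by
    intro k
    by_contra h
    have := hcK k
    rw [not_nonempty_iff_eq_empty.mp h, image_empty, measure_empty] at this
    exact this.not_gt (hc k).1
  choose g hg hsec using fun k => exists_measurable_section_of_isCompact hF (hK k) (hne k)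
  have hmeas : ∀ k, MeasurableSet (F '' K k) := fun k => ((hK k).image hF).isClosed.measurableSet
  have hnull : m (⋃ k, F '' K k)ᶜ = 0 := by
    rw [measure_compl (MeasurableSet.iUnion hmeas) (measure_ne_top _ _), tsub_eq_zero_iff_le]
    exact le_of_tendsto' hclim fun k => (hcK k).trans (measure_mono (subset_iUnion (fun k => F '' K k) k))
  -- Each `y` uses the section of the first compact image containing it. The second disjunct makes
  -- the search succeed, with index 0, on the null set that no image covers.
  let p : ℕ → Y → Prop := fun k y => y ∈ F '' K k ∨ y ∉ ⋃ k, F '' K k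
  have hp : ∀ y, ∃ k, p k y := fun y => by
    by_cases hy : y ∈ ⋃ k, F '' K k
    · obtain ⟨k, hk⟩ := mem_iUnion.mp hy
      exact ⟨k, Or.inl hk⟩
    · exact ⟨0, Or.inr hy⟩
  have hpm : ∀ k, MeasurableSet {y | p k y} := fun k =>
    (hmeas k).union (MeasurableSet.iUnion hmeas).compl
  refine ⟨fun y => g (Nat.find (hp y)) y, Measurable.find hg hpm hp, ?_⟩
  filter_upwards [compl_mem_ae_iff.mpr hnull] with y hy
  rw [mem_compl_iff, notMem_compl_iff] at hy
  exact hsec _ _ ((Nat.find_spec (hp y)).resolve_right (not_not.mpr hy))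

/-- A Borel map of a Souslin space onto a separable metrizable space has a Borel section almost
everywhere for any finite measure. -/
theorem exists_ae_section {X : Type u} {Y : Type v} [TopologicalSpace X] [SouslinSpace X]
    [MeasurableSpace X] [BorelSpace X] [TopologicalSpace Y] [MetrizableSpace Y]
    [SecondCountableTopology Y] [MeasurableSpace Y] [BorelSpace Y] {f : X → Y} (hf : Measurable f)
    (hs : Function.Surjective f) (m : Measure Y) [IsFiniteMeasure m] :
    ∃ g : Y → X, Measurable g ∧ ∀ᵐ y ∂m, f (g y) = y := by
  rcases (AnalyticSet_def (univ : Set X) ▸ SouslinSpace.analyticSet_univ (X := X)) with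
    h0 | ⟨φ, hφ, hr⟩
  · have : IsEmpty X := univ_eq_empty_iff.mp h0
    have : IsEmpty Y := ⟨fun y => (hs y).elim fun x _ => isEmptyElim x⟩
    exact ⟨isEmptyElim, measurable_of_empty _, Eventually.of_forall isEmptyElim⟩
  have hφs : Function.Surjective φ := range_eq_univ.mp hr
  have hfφ : Measurable (f ∘ φ) := hf.comp hφ.measurable
  -- The Polish topology of the Baire space is refined to another Polish one that makes `f ∘ φ`
  -- continuous; the refined space is again a continuous image of the Baire space. As the topology
  -- `t` is finer, `ψ` is also continuous for the original one.
  obtain ⟨ψ, hψ, hc, hψs⟩ : ∃ ψ : (ℕ → ℕ) → (ℕ → ℕ), Continuous ψ ∧ Continuous ((f ∘ φ) ∘ ψ) ∧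
      Function.Surjective ψ := by
    obtain ⟨t, ht, hcont, hpol⟩ := hfφ.exists_continuous
    obtain ⟨ψ, hψ, hψs⟩ :=
      @PolishSpace.exists_nat_nat_continuous_surjective (ℕ → ℕ) t hpol inferInstance
    exact ⟨ψ, @continuous_le_rng _ _ ψ Pi.topologicalSpace t Pi.topologicalSpace ht hψ,
      @Continuous.comp _ _ _ Pi.topologicalSpace t _ _ _ hcont hψ, hψs⟩
  obtain ⟨g, hg, hsec⟩ := exists_ae_section_of_baire hc ((hs.comp hφs).comp hψs) m
  exact ⟨fun y => φ (ψ (g y)), (hφ.measurable.comp hψ.measurable).comp hg, hsec⟩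

instance SouslinSpace.prod (X : Type u) (Y : Type v) [TopologicalSpace X] [TopologicalSpace Y]
    [SouslinSpace X] [SouslinSpace Y] : SouslinSpace (X × Y) := by
  obtain ⟨P, _, _, f, hf, hfr⟩ := analyticSet_iff_exists_polishSpace_range.mp
    (SouslinSpace.analyticSet_univ (X := X))
  obtain ⟨Q, _, _, g, hg, hgr⟩ := analyticSet_iff_exists_polishSpace_range.mp
    (SouslinSpace.analyticSet_univ (X := Y))
  refine ⟨?_⟩
  rw [← ((range_eq_univ.mp hfr).prodMap (range_eq_univ.mp hgr)).range_eq]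
  exact analyticSet_range_of_polishSpace (hf.prodMap hg)

/-! ### Lifting conditional probability systems through surjections -/

namespace CPS

/-- The pushforward of conditional probability systems by a Borel map of a Souslin space onto a
separable metrizable space is surjective. -/
theorem push_surjective {X : Type u} {Y : Type v} [TopologicalSpace X] [SouslinSpace X]
    [MeasurableSpace X] [BorelSpace X] [TopologicalSpace Y] [MetrizableSpace Y]
    [SecondCountableTopology Y] [MeasurableSpace Y] [BorelSpace Y]
    {ℬ : Set (Set X)} {𝒞 : Set (Set Y)} [Countable 𝒞] (f : X → Y) (hf : Measurable f)
    (h𝒞 : ∀ C ∈ 𝒞, MeasurableSet C) (hfam : (fun C => f ⁻¹' C) '' 𝒞 = ℬ)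
    (hs : Function.Surjective f) : Function.Surjective (push f hf h𝒞 hfam) := by
  intro μ
  -- A finite measure dominating all the countably many `μ(· | C)`. The chain rule compares the same
  -- set under two conditionals, so both must be lifted by the same section.
  obtain ⟨m, _, hm, -⟩ := exists_isFiniteMeasure_absolutelyContinuous
    (Measure.sum fun C : 𝒞 => (μ.1 C : Measure Y))
  obtain ⟨g, hg, hsec⟩ := exists_ae_section hf hs m
  have hae : ∀ C : 𝒞, ∀ᵐ y ∂(μ.1 C : Measure Y), f (g y) = y := fun C =>
    (Measure.absolutelyContinuous_of_le (Measure.le_sum _ C)).trans hm |>.ae_le hsec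
  have hex : ∀ B : ℬ, ∃ C : 𝒞, f ⁻¹' C = B := by
    rintro ⟨B, hB⟩
    obtain ⟨C, hC, rfl⟩ := hfam ▸ hB
    exact ⟨⟨C, hC⟩, rfl⟩
  -- Surjectivity of `f` makes taking preimages injective, so `c` inverts `C ↦ f ⁻¹' C`; the lift at
  -- `B` is the image under `g` of `μ(· | c B)`.
  choose c hc using hex
  have hgB : ∀ (B : ℬ) (D : 𝒞), (μ.1 D : Measure Y) (g ⁻¹' B) = (μ.1 D : Measure Y) (c B) := by
    intro B D
    refine measure_congr ?_
    filter_upwards [hae D] with y hy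
    refine propext ?_
    change g y ∈ (B : Set X) ↔ y ∈ (c B : Set Y)
    rw [← hc B, mem_preimage, hy]
  refine ⟨⟨fun B => (μ.1 (c B)).map hg.aemeasurable, ⟨fun B => ?_, fun A B C hA hAB hBC => ?_⟩⟩, ?_⟩
  · have hB : MeasurableSet (B : Set X) := hc B ▸ hf (h𝒞 _ (c B).2)
    rw [ProbabilityMeasure.map_apply' _ _ hB, hgB]
    exact μ.2.self _
  · have hB : MeasurableSet (B : Set X) := hc B ▸ hf (h𝒞 _ (c B).2)
    rw [ProbabilityMeasure.map_apply' _ _ hA, ProbabilityMeasure.map_apply' _ _ hA,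
      ProbabilityMeasure.map_apply' _ _ hB, hgB]
    -- If `g y` lies in `A ⊆ B = f ⁻¹' (c B)`, then almost surely `y = f (g y)` lies in `c B`.
    -- Intersecting with `c B` thus changes nothing, and supplies the inclusion that the chain rule
    -- for `μ` requires.
    have hA' : ∀ D : 𝒞, (μ.1 D : Measure Y) (g ⁻¹' A ∩ c B) = (μ.1 D : Measure Y) (g ⁻¹' A) := by
      intro D
      refine measure_congr ?_
      filter_upwards [hae D] with y hy
      refine propext ⟨fun h => h.1, fun h => ⟨h, ?_⟩⟩
      have : g y ∈ f ⁻¹' (c B : Set Y) := hc B ▸ hAB h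
      rwa [mem_preimage, hy] at this
    rw [← hA', ← hA']
    refine μ.2.chain _ (c B) (c C) ((hg hA).inter (h𝒞 _ (c B).2)) inter_subset_right ?_
    exact hs.preimage_subset_preimage_iff.mp (by rwa [hc, hc])
  · apply Subtype.ext
    funext C
    apply Subtype.ext
    change Measure.map f (Measure.map g _) = _
    have hcC : ∀ h, c ⟨f ⁻¹' (C : Set Y), h⟩ = C := fun h =>
      Subtype.ext (hs.preimage_injective (hc ⟨_, h⟩))
    rw [hcC, Measure.map_map hf hg]
    exact (Measure.map_congr (hae C)).trans Measure.map_id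

/-- The pushforward of conditional probability systems by a continuous map is continuous. -/
theorem continuous_push {X : Type u} {Y : Type v} [TopologicalSpace X] [MeasurableSpace X]
    [OpensMeasurableSpace X] [TopologicalSpace Y] [MeasurableSpace Y] [BorelSpace Y]
    {ℬ : Set (Set X)} {𝒞 : Set (Set Y)} (f : X → Y) (hf : Measurable f) (hfc : Continuous f)
    (h𝒞 : ∀ C ∈ 𝒞, MeasurableSet C) (hfam : (fun C => f ⁻¹' C) '' 𝒞 = ℬ) :
    Continuous (push f hf h𝒞 hfam) :=
  Continuous.subtype_mk (continuous_pi fun _ => (ProbabilityMeasure.continuous_map hfc).comp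
    ((continuous_apply _).comp continuous_subtype_val)) _

end CPS

/-! ### Hierarchies generated by complete type structures -/

section

variable {S : Type u} [TopologicalSpace S] [MetrizableSpace S] [SouslinSpace S]
  [MeasurableSpace S] [BorelSpace S] {ℬ : ConditioningFamilies S}

/-- Coherence recovers the last CPS of the shorter tuple as a marginal of the new entry, so by
hypothesis the new entry fixes the shorter tuple too. -/
theorem HierarchyStep.last_next_injective {L : HierarchyStep S} {i : Bool}
    (hL : Function.Injective (L.last i)) : Function.Injective (L.next.last i) := by
  rintro ⟨⟨x, μ⟩, hx⟩ ⟨⟨y, ν⟩, hy⟩ h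
  obtain rfl : μ = ν := h
  obtain rfl : x = y := hL (hx.symm.trans hy)
  rfl

/-- A coherent tuple is determined by its last entry. -/
theorem ConditioningFamilies.lastEntry_injective (i : Bool) :
    ∀ n, Function.Injective (ℬ.lastEntry i n)
  | 0 => fun _ _ h => h
  | n + 1 => HierarchyStep.last_next_injective (lastEntry_injective i n)

namespace TypeStructure

/-- The inductive step of (i): `(Id, h_j)` is onto, so the last entry lifts to `S × T_j` and is
realized by a type. Only last entries need to be matched, since they determine the tuple. -/
theorem HierarchyMaps.nextH_surjective {𝒯 : TypeStructure.{u, v} ℬ} {L : HierarchyStep S}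
    (M : 𝒯.HierarchyMaps L) (hS : 𝒯.Souslin) (hC : 𝒯.Complete) {i : Bool}
    (hL : Function.Injective (L.last i)) (hM : Function.Surjective (M.h (!i))) :
    Function.Surjective (M.nextH i) := by
  intro x
  have := hS (!i)
  obtain ⟨ν, hν⟩ := CPS.push_surjective (M.nextDom i) (M.measurable_nextDom i)
    (L.nextFam_measurable i) (M.preimage_nextFam i) (Function.surjective_id.prodMap hM) x.last
  obtain ⟨t, rfl⟩ := hC i ν
  exact ⟨t, HierarchyStep.last_next_injective hL hν⟩

/-- In a complete Souslin type structure all finite coherent hierarchies are generated. -/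
theorem finiteHierarchy_surjective {𝒯 : TypeStructure.{u, v} ℬ} (hS : 𝒯.Souslin)
    (hC : 𝒯.Complete) (n : ℕ) : ∀ i, Function.Surjective (𝒯.finiteHierarchy i n) := by
  induction n with
  | zero =>
    intro i μ
    have := hS (!i)
    have : Countable (ℬ.ev i) := (ℬ.countable i).to_subtype
    obtain ⟨ν, hν⟩ := CPS.push_surjective (Prod.fst : S × 𝒯.T (!i) → S) measurable_fst
      (ℬ.isConditioningFamily i).measurableSet rfl Prod.fst_surjective μ
    obtain ⟨t, rfl⟩ := hC i ν
    exact ⟨t, hν⟩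
  | succ n ih =>
    exact fun i => (𝒯.hierarchyMaps n).nextH_surjective hS hC
      (ConditioningFamilies.lastEntry_injective i n) (ih (!i))

/-- Continuity of pushforward passes from `h_j` at one order to `h_i` at the next. In (ii) this
makes the set of types with a given finite hierarchy closed. -/
theorem continuous_finiteHierarchy {𝒯 : TypeStructure.{u, v} ℬ} (hβ : 𝒯.IsContinuous) (n : ℕ) :
    ∀ i, Continuous (𝒯.finiteHierarchy i n) := by
  induction n with
  | zero =>
    exact fun i => (CPS.continuous_push Prod.fst measurable_fst continuous_fst
      (ℬ.isConditioningFamily i).measurableSet rfl).comp (hβ i)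
  | succ n ih =>
    intro i
    refine Continuous.subtype_mk ((ih i).prodMk ((CPS.continuous_push
      ((𝒯.hierarchyMaps n).nextDom i) ((𝒯.hierarchyMaps n).measurable_nextDom i) ?_
      ((hierarchyStep ℬ n).nextFam_measurable i)
      ((𝒯.hierarchyMaps n).preimage_nextFam i)).comp (hβ i))) _
    exact continuous_fst.prodMk ((ih (!i)).comp continuous_snd)

theorem lastEntry_finiteHierarchy (𝒯 : TypeStructure.{u, v} ℬ) (i : Bool) (n : ℕ) (t : 𝒯.T i) :
    ℬ.lastEntry i n (𝒯.finiteHierarchy i n t) = 𝒯.hierarchy i t n :=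
  (𝒯.hierarchyMaps n).last_h i t

/-- Every type generates a collectively coherent hierarchy. -/
theorem hierarchy_mem (𝒯 : TypeStructure.{u, v} ℬ) (i : Bool) (t : 𝒯.T i) :
    𝒯.hierarchy i t ∈ ℬ.Hierarchies i :=
  ⟨fun n => 𝒯.finiteHierarchy i n t, fun _ => rfl, fun n => 𝒯.lastEntry_finiteHierarchy i n t⟩

theorem Compact.souslin {𝒯 : TypeStructure.{u, v} ℬ} (hK : 𝒯.Compact) : 𝒯.Souslin := by
  intro i
  have := hK i
  let _ := metrizableSpaceMetric (𝒯.T i)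
  exact ⟨isClosed_univ.analyticSet⟩

/-- In a complete, compact and continuous type structure all collectively coherent hierarchies are
generated. -/
theorem range_hierarchy {𝒯 : TypeStructure.{u, v} ℬ} (hC : 𝒯.Complete) (hK : 𝒯.Compact)
    (hβ : 𝒯.IsContinuous) (i : Bool) : range (𝒯.hierarchy i) = ℬ.Hierarchies i := by
  refine Subset.antisymm (range_subset_iff.mpr (𝒯.hierarchy_mem i)) ?_
  rintro μ ⟨x, hx, hxμ⟩
  have := hK i
  have hcl : ∀ n, IsClosed {t | 𝒯.finiteHierarchy i n t = x n} := fun n =>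
    isClosed_eq (continuous_finiteHierarchy hβ n i) continuous_const
  -- Truncating the hierarchy generated by `t` gives its hierarchy of the previous order by
  -- definition, and `x` is compatible with truncation, so the sets are nested; they are non-empty
  -- by the finite-order result.
  obtain ⟨t, ht⟩ := IsCompact.nonempty_iInter_of_sequence_nonempty_isCompact_isClosed
    (fun n => {t | 𝒯.finiteHierarchy i n t = x n})
    (fun n t (ht : 𝒯.finiteHierarchy i (n + 1) t = x (n + 1)) =>
      (congrArg (ℬ.truncate i n) ht).trans (hx n))
    (fun n => finiteHierarchy_surjective hK.souslin hC n i (x n))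
    (hcl 0).isCompact hcl
  refine ⟨t, funext fun n => ?_⟩
  rw [← lastEntry_finiteHierarchy, ← hxμ n]
  exact congrArg _ (mem_iInter.mp ht n)

end TypeStructure

end

theorem theorem1 {S : Type u} [TopologicalSpace S] [MetrizableSpace S] [SouslinSpace S]
    [MeasurableSpace S] [BorelSpace S] (ℬ : ConditioningFamilies S)
    (𝒯 : TypeStructure.{u, v} ℬ) :
    (𝒯.Souslin → 𝒯.Complete →
      TypeStructure.FinitelyTerminal.{u, v, w} 𝒯 ∧
      ∀ i n, range (𝒯.finiteHierarchy i n) = univ) ∧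
    (𝒯.Complete → 𝒯.Compact → 𝒯.IsContinuous →
      TypeStructure.Terminal.{u, v, w} 𝒯 ∧
      ∀ i, range (𝒯.hierarchy i) = ℬ.Hierarchies i) := by
  refine ⟨fun hS hC => ⟨fun 𝒯' i t' n => ?_, fun i n =>
    (TypeStructure.finiteHierarchy_surjective hS hC n i).range_eq⟩, fun hC hK hβ =>
    ⟨fun 𝒯' i t' => ?_, TypeStructure.range_hierarchy hC hK hβ⟩⟩
  · obtain ⟨t, ht⟩ := TypeStructure.finiteHierarchy_surjective hS hC n i
      (𝒯'.finiteHierarchy i n t')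
    exact ⟨t, ht.symm⟩
  · obtain ⟨t, ht⟩ : 𝒯'.hierarchy i t' ∈ range (𝒯.hierarchy i) :=
      TypeStructure.range_hierarchy hC hK hβ i ▸ 𝒯'.hierarchy_mem i t'
    exact ⟨t, ht.symm⟩
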